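/- A Borel set $B\subseteq\mathbb{R}$ is called \emph{measured} if there is a translation invariant Borel measure $\mu$ on $\mathbb{R}$ with $\mu(B)>0$ such that $B$ has $\sigma$-finite $\mu$-measure. Let $X$ be an infinite-dimensional real Banach space with a Schauder basis $(e_i)_{i\ge 1}$ satisfying $\|e_i\|=1$ for all $i$, and let $2\le n_1\le n_2\le\cdots$ be integers with $n_i\to\infty$. If $k_i\in\mathbb{Z}$ are such that the series $\sum_{i=1}^\infty \frac{k_i}{n_i}e_i$ converges in $X$, then $\sum_{i=1}^\infty \frac{k_i}{n_1\cdots n_i}$ converges in $\mathbb{R}$. Let $$A=\left\{\sum_{i=1}^\infty \frac{k_i}{n_1\cdots n_i}\ :\ k_i\in\mathbb{Z}\text{ and }\sum_{i=1}^\infty \frac{k_i}{n_i}e_i\text{ converges in }X\right\}.$$ Then $A$ is a Borel additive subgroup of $\mathbb{R}$, and $A$ is not a union of countably many measured sets. If moreover the basis is boundedly complete, that is, $\sum_i a_ie_i$ converges whenever $a_i\in\mathbb{R}$ and $\sup_N\left\|\sum_{i=1}^N a_ie_i\right\|<\infty$, then $A$ is $\sigma$-compact. For every $1\le p<\infty$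 the standard unit vectors form a normalized boundedly complete Schauder basis of $\ell_p$, so this applies to $\ell_p$. -/

import Mathlib

open Filter Topology MeasureTheory

/-- A set `B ⊆ ℝ` is measured if it is Borel and some translation invariant Borel measure on `ℝ`
assigns positive and `σ`-finite measure to `B`. The measure itself is not assumed to be
`σ`-finite or locally finite. -/
def IsMeasured (B : Set ℝ) : Prop :=
  MeasurableSet B ∧
    ∃ μ : Measure ℝ, μ.IsAddLeftInvariant ∧ 0 < μ B ∧ SigmaFinite (μ.restrict B)

/-- `A` is a union of countably many (possibly finitely many) measured sets. -/
def IsCountableUnionOfMeasured (A : Set ℝ) : Prop :=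
  ∃ F : Set (Set ℝ), F.Countable ∧ (∀ B ∈ F, IsMeasured B) ∧ ⋃₀ F = A

/-- The series `∑ u i` converges, i.e. its sequence of partial sums has a limit. -/
def SeriesConverges {E : Type*} [AddCommMonoid E] [TopologicalSpace E] (u : ℕ → E) : Prop :=
  ∃ s : E, Tendsto (fun N => ∑ i ∈ Finset.range N, u i) atTop (𝓝 s)

/-- A Schauder basis is boundedly complete if every series `∑ a i • e i` with bounded partial
sums converges. -/
def IsBoundedlyComplete {X : Type*} [NormedAddCommGroup X] [NormedSpace ℝ X]
    (e : SchauderBasis ℝ X) : Prop :=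
  ∀ a : ℕ → ℝ, (∃ M : ℝ, ∀ N : ℕ, ‖∑ i ∈ Finset.range N, a i • e i‖ ≤ M) →
    SeriesConverges (fun i => a i • e i)

/-- The terms `k i / (n 0 * n 1 * ⋯ * n i)` of a Cantor-type series. -/
noncomputable def cantorTerm (n : ℕ → ℕ) (k : ℕ → ℤ) (i : ℕ) : ℝ :=
  (k i : ℝ) / ∏ j ∈ Finset.range (i + 1), (n j : ℝ)

/-- The terms `(k i / n i) e i` of the associated series in the Banach space. -/
noncomputable def basisTerm {X : Type*} [NormedAddCommGroup X] [NormedSpace ℝ X]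
    (e : SchauderBasis ℝ X) (n : ℕ → ℕ) (k : ℕ → ℤ) (i : ℕ) : X :=
  ((k i : ℝ) / (n i : ℝ)) • e i

/-- The set of all sums `∑ k i / (n 0 * ⋯ * n i)`, where `k` runs over the integer sequences for
which `∑ (k i / n i) e i` converges in `X`. -/
def banachSubgroupSet {X : Type*} [NormedAddCommGroup X] [NormedSpace ℝ X]
    (e : SchauderBasis ℝ X) (n : ℕ → ℕ) : Set ℝ :=
  {x : ℝ | ∃ k : ℕ → ℤ, SeriesConverges (basisTerm e n k) ∧
    Tendsto (fun N => ∑ i ∈ Finset.range N, cantorTerm n k i) atTop (𝓝 x)}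

/-!
`A` is the image, under a continuous homomorphism, of the closed subgroup `Y` of `X` consisting of
the sums `∑ (k i / n i) e i`, and the kernel of this homomorphism is discrete. As `n i → ∞`, the
group `Y` is not locally compact, so neither is its quotient `Q` by the kernel, a Polish group
which injects into `ℝ` with image `A`.

A translation invariant measure witnessing that `B ⊆ A` is measured pulls back to `Q`. Restricted
to the preimage of `B` it is carried by a `σ`-compact set, and by invariance what remains of the
preimage is Haar null. Since a countable union of Haar null sets is Haar null (Christensen), if `A`
were a union of countably many measured sets then `Q = N ∪ S` with `N` Haar null and `S`
`σ`-compact. For every `g`, a witness `ν` for `N`, carried by a `σ`-compact set `C`, satisfies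
`ν (N - g) = 0`, so `C` meets `S - g`. Hence `Q = S - C` is `σ`-compact, which by Baire's theorem
makes it locally compact.
-/

open scoped Pointwise

theorem map_update_infinitePi_prod {ι : Type*} [DecidableEq ι] {Ω : ι → Type*}
    [∀ i, MeasurableSpace (Ω i)] (P : ∀ i, Measure (Ω i)) [∀ i, IsProbabilityMeasure (P i)]
    (j : ι) :
    ((Measure.infinitePi P).prod (P j)).map (fun q => Function.update q.1 j q.2) =
      Measure.infinitePi P := by
  refine Measure.eq_infinitePi P fun s t ht => ?_
  have hpre : (fun q : (∀ i, Ω i) × Ω j => Function.update q.1 j q.2) ⁻¹' Set.pi s t =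
      Set.pi (s.erase j : Finset ι) t ×ˢ {b | j ∈ s → b ∈ t j} := by
    ext q
    simp only [Set.mem_preimage, Set.update_mem_pi_iff, Set.mem_prod, Finset.coe_erase,
      Finset.mem_coe, Set.mem_ofPred_eq]
  rw [Measure.map_apply measurable_update' (.pi s.countable_toSet fun i _ => ht i), hpre,
    Measure.prod_prod, Measure.infinitePi_pi _ fun i _ => ht i]
  by_cases hj : j ∈ s
  · simpa only [hj, forall_const, Set.ofPred_mem_eq] using
      Finset.prod_erase_mul s (fun i => P i (t i)) hj
  · simp [hj]

theorem ae_summable_infinitePi {E : Type*} [NormedAddCommGroup E] [CompleteSpace E]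
    [MeasurableSpace E] {P : ℕ → Measure E} [∀ i, IsProbabilityMeasure (P i)] {u : ℕ → ℝ}
    (hu : Summable u) (hP : ∀ i, ∀ᵐ y ∂P i, ‖y‖ ≤ u i) :
    ∀ᵐ z ∂Measure.infinitePi P, Summable z := by
  have hz : ∀ᵐ z ∂Measure.infinitePi P, ∀ i, ‖z i‖ ≤ u i := ae_all_iff.2 fun i =>
    (measurePreserving_eval_infinitePi P i).quasiMeasurePreserving.ae (hP i)
  exact hz.mono fun z hz => hu.of_norm_bounded hz

theorem exists_isSigmaCompact_measure_compl_eq_zero {Y : Type*} [TopologicalSpace Y]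
    [PolishSpace Y] [MeasurableSpace Y] [BorelSpace Y] (ν : Measure Y) [SFinite ν] :
    ∃ S : Set Y, IsSigmaCompact S ∧ ν Sᶜ = 0 := by
  choose K hK hlt using fun m : ℕ => exists_isCompact_closure_measure_compl_lt ν.toFinite
    ((m : ENNReal) + 1)⁻¹ (by simp)
  refine ⟨⋃ m, closure (K m), isSigmaCompact_iUnion_of_isCompact _ hK,
    absolutelyContinuous_toFinite ν ?_⟩
  have hle (m : ℕ) : ν.toFinite (⋃ m, closure (K m))ᶜ ≤ ((m : ENNReal) + 1)⁻¹ :=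
    (measure_mono <| Set.compl_subset_compl.2 <|
      subset_closure.trans <| Set.subset_iUnion (fun m => closure (K m)) m).trans (hlt m).le
  have hlim : Tendsto (fun m : ℕ => ((m : ENNReal) + 1)⁻¹) atTop (𝓝 0) := by
    exact_mod_cast (tendsto_add_atTop_iff_nat 1).2 ENNReal.tendsto_inv_nat_nhds_zero
  exact le_antisymm (ge_of_tendsto' hlim hle) bot_le

theorem isSigmaCompact_sub {G : Type*} [TopologicalSpace G] [AddGroup G]
    [IsTopologicalAddGroup G] {S T : Set G} (hS : IsSigmaCompact S) (hT : IsSigmaCompact T) :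
    IsSigmaCompact (S - T) := by
  obtain ⟨K, hK, rfl⟩ := hS
  obtain ⟨L, hL, rfl⟩ := hT
  simp only [Set.iUnion_sub, Set.sub_iUnion]
  refine isSigmaCompact_iUnion _ fun i => isSigmaCompact_iUnion_of_isCompact _ fun j => ?_
  exact sub_eq_add_neg (K j) (L i) ▸ (hK j).add (hL i).neg

theorem locallyCompactSpace_of_isSigmaCompact_univ {G : Type*} [TopologicalSpace G] [AddGroup G]
    [IsTopologicalAddGroup G] [BaireSpace G] (h : IsSigmaCompact (Set.univ : Set G)) :
    LocallyCompactSpace G := by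
  obtain ⟨K, hK, hKu⟩ := h
  obtain ⟨i, x, hx⟩ := nonempty_interior_of_iUnion_of_closed (fun i => isClosed_closure (s := K i))
    (Set.univ_subset_iff.1 (hKu.ge.trans (Set.iUnion_mono fun i => subset_closure)))
  exact (hK i).closure.locallyCompactSpace_of_mem_nhds_of_addGroup (mem_interior_iff_mem_nhds.1 hx)

section HaarNull

variable {Y : Type*} [NormedAddCommGroup Y] [MeasurableSpace Y]

/-- Haar null sets in the sense of Christensen: all translates of `N` are null for one Borel
probability measure. Only meaningful for Borel `N`, as no measurable hull is taken. -/
def IsHaarNull (N : Set Y) : Prop :=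
  ∃ ν : Measure Y, IsProbabilityMeasure ν ∧ ∀ g, ν ((· + g) ⁻¹' N) = 0

theorem isHaarNull_of_sFinite {N : Set Y} (ν : Measure Y) [SFinite ν] [NeZero ν]
    (h : ∀ g, ν ((· + g) ⁻¹' N) = 0) : IsHaarNull N :=
  ⟨ν.toFinite, inferInstance, fun g => toFinite_absolutelyContinuous ν (h g)⟩

variable [BorelSpace Y] [SecondCountableTopology Y]

theorem IsHaarNull.exists_ae_norm_le {N : Set Y} (hN : IsHaarNull N) {ε : ℝ} (hε : 0 < ε) :
    ∃ ν : Measure Y, IsProbabilityMeasure ν ∧ (∀ᵐ y ∂ν, ‖y‖ ≤ ε) ∧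
      ∀ g, ν ((· + g) ⁻¹' N) = 0 := by
  obtain ⟨ν, hν, hnull⟩ := hN
  obtain ⟨d, -, hd⟩ : ∃ d ∈ Set.univ, ∀ t ∈ 𝓝[Set.univ] d, 0 < ν t :=
    exists_mem_forall_mem_nhdsWithin_pos_measure (by simp)
  have hball : ν (Metric.closedBall d ε) ≠ 0 :=
    (hd _ (mem_nhdsWithin_of_mem_nhds (Metric.closedBall_mem_nhds d hε))).ne'
  have := ProbabilityTheory.cond_isProbabilityMeasure hball
  let φ := MeasurableEquiv.subRight d
  refine ⟨(ProbabilityTheory.cond ν (Metric.closedBall d ε)).map φ,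
    Measure.isProbabilityMeasure_map φ.measurable.aemeasurable, ?_, fun g => ?_⟩
  · rw [φ.measurableEmbedding.ae_map_iff]
    filter_upwards [ProbabilityTheory.ae_cond_mem Metric.isClosed_closedBall.measurableSet]
      with y hy
    exact (dist_eq_norm y d).symm.trans_le hy
  · rw [φ.map_apply]
    refine ProbabilityTheory.cond_absolutelyContinuous ?_
    convert hnull (g - d) using 2
    ext y
    change y - d + g ∈ N ↔ y + (g - d) ∈ N
    rw [sub_add_eq_add_sub, add_sub_assoc]

/- The common witness is the law of a convergent series of independent small witnesses: conditioned
on all the other summands, the sum is a translate of the `n`-th one. -/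
theorem IsHaarNull.iUnion [CompleteSpace Y] {N : ℕ → Set Y} (hm : ∀ n, MeasurableSet (N n))
    (hN : ∀ n, IsHaarNull (N n)) : IsHaarNull (⋃ n, N n) := by
  choose P hP hsmall hnull using fun n : ℕ =>
    (hN n).exists_ae_norm_le (ε := (1 / 2) ^ n) (by positivity)
  have hsum : Measurable fun z : ℕ → Y => ∑' i, z i := by fun_prop
  refine ⟨(Measure.infinitePi P).map fun z => ∑' i, z i,
    Measure.isProbabilityMeasure_map hsum.aemeasurable, fun g => ?_⟩
  rw [Set.preimage_iUnion]
  refine measure_iUnion_null fun n => ?_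
  have hNg : MeasurableSet ((· + g) ⁻¹' N n) := measurable_add_const g (hm n)
  rw [Measure.map_apply hsum hNg, ← map_update_infinitePi_prod P n,
    Measure.map_apply measurable_update' (hsum hNg),
    Measure.measure_prod_null (measurable_update' (hsum hNg))]
  filter_upwards [ae_summable_infinitePi summable_geometric_two hsmall] with z hz
  refine (congrArg (P n) ?_).trans (hnull n (-z n + ∑' i, z i + g))
  ext a
  simp only [Set.mem_preimage, (hz.hasSum.update n a).tsum_eq]
  congr! 1
  abel

theorem IsHaarNull.union_ne_univ [CompleteSpace Y] (hY : ¬ LocallyCompactSpace Y) {N S : Set Y}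
    (hN : IsHaarNull N) (hS : IsSigmaCompact S) : N ∪ S ≠ Set.univ := by
  intro hNS
  obtain ⟨ν, hν, hnull⟩ := hN
  obtain ⟨C, hC, hC0⟩ := exists_isSigmaCompact_measure_compl_eq_zero ν
  suffices S - C = Set.univ from
    hY (locallyCompactSpace_of_isSigmaCompact_univ (this ▸ isSigmaCompact_sub hS hC))
  refine Set.eq_univ_of_forall fun g => ?_
  have hae : ∀ᵐ y ∂ν, y ∈ C ∧ y + g ∉ N := by
    refine Eventually.and hC0 ?_
    simpa only [ae_iff, not_not] using! hnull g
  obtain ⟨y, hyC, hyN⟩ := hae.exists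
  have hyS : y + g ∈ S := (hNS.ge (Set.mem_univ (y + g))).resolve_left hyN
  exact ⟨y + g, hyS, y, hyC, add_sub_cancel_left y g⟩

end HaarNull

section Measured

theorem measurableSet_of_isSigmaCompact {Y : Type*} [TopologicalSpace Y] [T2Space Y]
    [MeasurableSpace Y] [OpensMeasurableSpace Y] {S : Set Y} (hS : IsSigmaCompact S) :
    MeasurableSet S := by
  obtain ⟨K, hK, rfl⟩ := hS
  exact .iUnion fun i => (hK i).measurableSet

theorem sigmaFinite_comap {α β : Type*} [MeasurableSpace α] [MeasurableSpace β]
    {f : α → β} (hf : MeasurableEmbedding f) (μ : Measure β) [SigmaFinite μ] :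
    SigmaFinite (μ.comap f) :=
  .of_map _ hf.measurable.aemeasurable (by rw [hf.map_comap]; infer_instance)

variable {Y : Type*} [NormedAddCommGroup Y] [SecondCountableTopology Y] [CompleteSpace Y]

theorem exists_isHaarNull_isSigmaCompact_of_isAddLeftInvariant [MeasurableSpace Y] [BorelSpace Y]
    (μ : Measure Y) [μ.IsAddLeftInvariant] {P : Set Y} (hP : MeasurableSet P) (hpos : μ P ≠ 0)
    [SFinite (μ.restrict P)] :
    ∃ N S, MeasurableSet N ∧ IsHaarNull N ∧ IsSigmaCompact S ∧ P ⊆ N ∪ S := by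
  obtain ⟨S, hS, hS0⟩ := exists_isSigmaCompact_measure_compl_eq_zero (μ.restrict P)
  have hSm : MeasurableSet S := measurableSet_of_isSigmaCompact hS
  have hnull : μ (P \ S) = 0 := by
    rwa [Measure.restrict_apply hSm.compl, Set.inter_comm, ← Set.sdiff_eq] at hS0
  have : NeZero (μ.restrict P) := ⟨by rwa [Ne, Measure.restrict_eq_zero]⟩
  refine ⟨P \ S, S, hP.diff hSm, isHaarNull_of_sFinite (μ.restrict P) fun g => ?_, hS, by simp⟩
  refine Measure.restrict_le_self.absolutelyContinuous ?_
  simpa only [add_comm _ g, measure_preimage_add] using hnull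

theorem IsMeasured.exists_isHaarNull_isSigmaCompact [MeasurableSpace Y] [BorelSpace Y]
    {Φ : Y →+ ℝ} (hc : Continuous Φ) (hinj : Function.Injective Φ) {B : Set ℝ} (hB : IsMeasured B)
    (hBΦ : B ⊆ Set.range Φ) :
    ∃ N S, MeasurableSet N ∧ IsHaarNull N ∧ IsSigmaCompact S ∧ Φ ⁻¹' B ⊆ N ∪ S := by
  obtain ⟨hBm, μ, hμ, hpos, hfin⟩ := hB
  have hΦ : MeasurableEmbedding Φ := hc.measurableEmbedding hinj
  have := Measure.IsAddLeftInvariant.comap μ hΦ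
  have : SigmaFinite ((μ.comap Φ).restrict (Φ ⁻¹' B)) :=
    hΦ.comap_restrict μ B ▸ sigmaFinite_comap hΦ (μ.restrict B)
  refine exists_isHaarNull_isSigmaCompact_of_isAddLeftInvariant (μ.comap Φ) (hc.measurable hBm) ?_
  rw [hΦ.comap_preimage, Set.inter_eq_left.2 hBΦ]
  exact hpos.ne'

theorem not_isCountableUnionOfMeasured_range_of_injective (hY : ¬ LocallyCompactSpace Y)
    {Φ : Y →+ ℝ} (hc : Continuous Φ) (hinj : Function.Injective Φ) :
    ¬ IsCountableUnionOfMeasured (Set.range Φ) := by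
  rintro ⟨F, hFc, hF, hFu⟩
  borelize Y
  have hne : F.Nonempty := by
    have : Φ 0 ∈ ⋃₀ F := hFu ▸ Set.mem_range_self 0
    exact Set.nonempty_sUnion.1 ⟨_, this⟩ |>.imp fun B hB => hB.1
  obtain ⟨f, rfl⟩ := hFc.exists_eq_range hne
  rw [Set.sUnion_range] at hFu
  choose N S hNm hN hS hsub using fun n => (hF (f n) ⟨n, rfl⟩).exists_isHaarNull_isSigmaCompact
    hc hinj (hFu ▸ Set.subset_iUnion f n)
  refine (IsHaarNull.iUnion hNm hN).union_ne_univ hY (isSigmaCompact_iUnion S hS) ?_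
  have hcov : ⋃ n, Φ ⁻¹' f n = Set.univ := by
    rw [← Set.preimage_iUnion, hFu, Set.preimage_range]
  rw [← Set.iUnion_union_distrib, ← Set.univ_subset_iff, ← hcov]
  exact Set.iUnion_mono hsub

theorem locallyCompactSpace_of_isLocalHomeomorph {G Q : Type*} [TopologicalSpace G]
    [TopologicalSpace Q] [LocallyCompactSpace Q] {f : G → Q} (hf : IsLocalHomeomorph f) :
    LocallyCompactSpace G := by
  refine ⟨fun x U hU => ?_⟩
  obtain ⟨φ, hx, rfl⟩ := hf x
  have hV : φ.target ∩ φ.symm ⁻¹' U ∈ 𝓝 (φ x) :=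
    inter_mem (φ.open_target.mem_nhds (φ.map_source hx)) (φ.tendsto_symm hx hU)
  obtain ⟨K, hK, hKV, hKc⟩ := local_compact_nhds hV
  refine ⟨φ.symm '' K, ?_, Set.image_subset_iff.2 (hKV.trans Set.inter_subset_right),
    hKc.image_of_continuousOn (φ.continuousOn_symm.mono (hKV.trans Set.inter_subset_left))⟩
  simpa only [φ.left_inv hx] using φ.symm.image_mem_nhds (φ.map_source hx) hK

theorem range_kerLift {G H : Type*} [AddGroup G] [AddGroup H] (f : G →+ H) :
    Set.range (QuotientAddGroup.kerLift f) = Set.range f :=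
  (QuotientAddGroup.mk_surjective.range_comp (QuotientAddGroup.kerLift f)).symm

theorem measurableSet_range_of_continuous {H : Type*} [AddGroup H] [TopologicalSpace H]
    [T2Space H] [MeasurableSpace H] [OpensMeasurableSpace H] {Φ : Y →+ H} (hc : Continuous Φ) :
    MeasurableSet (Set.range Φ) := by
  have : IsClosed (Φ.ker : Set Y) := isClosed_singleton.preimage hc
  have := QuotientAddGroup.completeSpace_left Y Φ.ker
  rw [← range_kerLift]
  exact measurableSet_range_of_continuous_injective (hc.quotient_lift _)
    (QuotientAddGroup.kerLift_injective Φ)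

theorem not_isCountableUnionOfMeasured_range (hY : ¬ LocallyCompactSpace Y) {Φ : Y →+ ℝ}
    (hc : Continuous Φ) (hker : IsDiscrete (Φ.ker : Set Y)) :
    ¬ IsCountableUnionOfMeasured (Set.range Φ) := by
  have : IsClosed (Φ.ker : Set Y) := isClosed_singleton.preimage hc
  have := QuotientAddGroup.completeSpace_left Y Φ.ker
  have hmk : IsLocalHomeomorph (QuotientAddGroup.mk (s := Φ.ker)) :=
    (Φ.ker.isAddQuotientCoveringMap_of_comm hker).isCoveringMap.isLocalHomeomorph
  rw [← range_kerLift]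
  exact not_isCountableUnionOfMeasured_range_of_injective
    (fun _ => hY (locallyCompactSpace_of_isLocalHomeomorph hmk)) (hc.quotient_lift _)
    (QuotientAddGroup.kerLift_injective Φ)

end Measured

section CantorSeries

variable {n : ℕ → ℕ}

theorem prod_range_cast_pos (hn : ∀ i, 2 ≤ n i) (i : ℕ) : 0 < ∏ j ∈ Finset.range i, (n j : ℝ) :=
  Finset.prod_pos fun j _ => Nat.cast_pos.2 (two_pos.trans_le (hn j))

theorem prod_range_mul_two_pow_le (hn : ∀ i, 2 ≤ n i) (i j : ℕ) :
    (∏ l ∈ Finset.range i, (n l : ℝ)) * 2 ^ j ≤ ∏ l ∈ Finset.range (i + j), (n l : ℝ) := by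
  induction j with
  | zero => simp
  | succ j ih =>
    rw [← add_assoc, Finset.prod_range_succ, pow_succ, ← mul_assoc]
    have := prod_range_cast_pos hn (i + j)
    have h2 : (2 : ℝ) ≤ n (i + j) := by exact_mod_cast hn _
    gcongr

theorem abs_div_prod_range_add_le (hn : ∀ i, 2 ≤ n i) {a : ℕ → ℝ} {M : ℝ} (ha : ∀ i, |a i| ≤ M)
    (i j : ℕ) : |a (i + j) / ∏ l ∈ Finset.range (i + j), (n l : ℝ)| ≤
      M / (∏ l ∈ Finset.range i, (n l : ℝ)) * (1 / 2) ^ j := by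
  have h := prod_range_cast_pos hn i
  have hM : 0 ≤ M := (abs_nonneg _).trans (ha 0)
  rw [abs_div, abs_of_pos (prod_range_cast_pos hn (i + j)), one_div, inv_pow, ← div_eq_mul_inv,
    div_div]
  exact div_le_div₀ hM (ha _) (by positivity) (prod_range_mul_two_pow_le hn i j)

theorem abs_div_prod_range_le (hn : ∀ i, 2 ≤ n i) {a : ℕ → ℝ} {M : ℝ} (ha : ∀ i, |a i| ≤ M)
    (i : ℕ) : |a i / ∏ l ∈ Finset.range i, (n l : ℝ)| ≤ M * (1 / 2) ^ i := by
  simpa only [zero_add, Finset.range_zero, Finset.prod_empty, div_one] using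
    abs_div_prod_range_add_le hn ha 0 i

theorem summable_div_prod_range (hn : ∀ i, 2 ≤ n i) {a : ℕ → ℝ} {M : ℝ} (ha : ∀ i, |a i| ≤ M) :
    Summable fun i => a i / ∏ l ∈ Finset.range i, (n l : ℝ) :=
  .of_norm_bounded (summable_geometric_two.mul_left M) (abs_div_prod_range_le hn ha)

theorem mul_abs_le_of_hasSum_div_prod_range_zero (hn : ∀ i, 2 ≤ n i) {a : ℕ → ℝ} {M : ℝ}
    (ha : ∀ i, |a i| ≤ M) (h0 : HasSum (fun i => a i / ∏ l ∈ Finset.range i, (n l : ℝ)) 0) {i : ℕ}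
    (hi : ∀ j < i, a j = 0) : n i * |a i| ≤ 2 * M := by
  have hpos := prod_range_cast_pos hn i
  have hpos' := prod_range_cast_pos hn (i + 1)
  have hhead : ∑ j ∈ Finset.range (i + 1), a j / ∏ l ∈ Finset.range j, (n l : ℝ) =
      a i / ∏ l ∈ Finset.range i, (n l : ℝ) := by
    rw [Finset.sum_range_succ, Finset.sum_eq_zero, zero_add]
    exact fun j hj => by rw [hi j (Finset.mem_range.1 hj), zero_div]
  have htail := (hasSum_nat_add_iff' (i + 1)).2 h0
  rw [hhead, zero_sub] at htail
  have hle : ‖-(a i / ∏ l ∈ Finset.range i, (n l : ℝ))‖ ≤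
      M / (∏ l ∈ Finset.range (i + 1), (n l : ℝ)) * 2 := by
    rw [← htail.tsum_eq]
    refine tsum_of_norm_bounded (hasSum_geometric_two.mul_left _) fun j => ?_
    rw [add_comm j]
    exact abs_div_prod_range_add_le hn ha (i + 1) j
  rw [norm_neg, Real.norm_eq_abs, abs_div, abs_of_pos hpos, div_mul_eq_mul_div,
    div_le_div_iff₀ hpos hpos', Finset.prod_range_succ, mul_comm M] at hle
  refine le_of_mul_le_mul_right ?_ hpos
  linarith

theorem cantorTerm_eq_div_prod_range (n : ℕ → ℕ) (k : ℕ → ℤ) :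
    cantorTerm n k = fun i => (k i / n i : ℝ) / ∏ l ∈ Finset.range i, (n l : ℝ) := by
  ext i
  rw [cantorTerm, Finset.prod_range_succ, div_div, mul_comm]

theorem eq_zero_of_hasSum_cantorTerm_zero (hn : ∀ i, 2 ≤ n i) {k : ℕ → ℤ} {M : ℝ} (hM : M < 1 / 2)
    (hk : ∀ i, |(k i / n i : ℝ)| ≤ M) (h0 : HasSum (cantorTerm n k) 0) : k = 0 := by
  ext i
  induction i using Nat.strong_induction_on with
  | _ i ih =>
  have hni : (0 : ℝ) < n i := Nat.cast_pos.2 (two_pos.trans_le (hn i))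
  have hle : n i * |(k i / n i : ℝ)| ≤ 2 * M :=
    mul_abs_le_of_hasSum_div_prod_range_zero hn hk (cantorTerm_eq_div_prod_range n k ▸ h0)
      fun j hj => by simp [ih j hj]
  rw [abs_div, abs_of_pos hni, mul_div_cancel₀ _ hni.ne'] at hle
  have hlt : |(k i : ℝ)| < 1 := by linarith
  exact Int.abs_lt_one_iff.1 (by exact_mod_cast hlt)

theorem summable_cantorTerm (hn : ∀ i, 2 ≤ n i) {k : ℕ → ℤ} {M : ℝ}
    (hk : ∀ i, |(k i / n i : ℝ)| ≤ M) : Summable (cantorTerm n k) :=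
  cantorTerm_eq_div_prod_range n k ▸ summable_div_prod_range hn hk

theorem continuousOn_tsum_cantorTerm (hn : ∀ i, 2 ≤ n i) (M : ℝ) :
    ContinuousOn (fun k : ℕ → ℤ => ∑' i, cantorTerm n k i) {k | ∀ i, |(k i / n i : ℝ)| ≤ M} := by
  refine continuousOn_tsum (u := fun i => M * (1 / 2) ^ i) (fun i => ?_)
    (summable_geometric_two.mul_left M) fun i k hk => ?_
  · have hdigit : Continuous fun m : ℤ => (m : ℝ) / ∏ j ∈ Finset.range (i + 1), (n j : ℝ) :=
      continuous_of_discreteTopology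
    exact (hdigit.comp (continuous_apply i)).continuousOn
  · rw [cantorTerm_eq_div_prod_range]
    exact abs_div_prod_range_le hn hk i

end CantorSeries

section SchauderBasis

theorem norm_le_of_norm_sum_range_le {E : Type*} [SeminormedAddCommGroup E] {v : ℕ → E} {M : ℝ}
    (h : ∀ N, ‖∑ i ∈ Finset.range N, v i‖ ≤ M) (i : ℕ) : ‖v i‖ ≤ 2 * M := by
  rw [← Finset.sum_range_succ_sub_sum v, two_mul]
  exact (norm_sub_le _ _).trans (add_le_add (h _) (h _))

variable {𝕜 X : Type*} [NontriviallyNormedField 𝕜] [NormedAddCommGroup X] [NormedSpace 𝕜 X]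

theorem norm_coeff_le_of_norm_sum_range_le {v : ℕ → X} {c : ℝ} (hc : 0 < c) (hv : ∀ i, c ≤ ‖v i‖)
    {a : ℕ → 𝕜} {M : ℝ} (h : ∀ N, ‖∑ i ∈ Finset.range N, a i • v i‖ ≤ M) (i : ℕ) :
    ‖a i‖ ≤ 2 * M / c := by
  rw [le_div_iff₀ hc]
  calc ‖a i‖ * c ≤ ‖a i‖ * ‖v i‖ := by gcongr; exact hv i
    _ = ‖a i • v i‖ := (norm_smul _ _).symm
    _ ≤ 2 * M := norm_le_of_norm_sum_range_le h i

variable (e : SchauderBasis 𝕜 X)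

theorem coord_eq_of_tendsto {a : ℕ → 𝕜} {x : X}
    (h : Tendsto (fun N => ∑ i ∈ Finset.range N, a i • e i) atTop (𝓝 x)) (i : ℕ) :
    e.coord i x = a i := by
  refine tendsto_nhds_unique (((e.coord i).continuous.tendsto x).comp h) ?_
  refine tendsto_const_nhds.congr' ?_
  filter_upwards [eventually_gt_atTop i] with N hN
  simp [e.ortho, Pi.single_apply, hN]

theorem seriesConverges_smul_iff {a : ℕ → 𝕜} :
    SeriesConverges (fun i => a i • e i) ↔ ∃ x, ∀ i, e.coord i x = a i := by
  refine ⟨fun ⟨x, hx⟩ => ⟨x, coord_eq_of_tendsto e hx⟩, fun ⟨x, hx⟩ => ⟨x, ?_⟩⟩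
  simpa only [e.proj_apply, hx] using e.tendsto_proj x

theorem eq_zero_of_coord_eq_zero {x : X} (h : ∀ i, e.coord i x = 0) : x = 0 := by
  refine tendsto_nhds_unique (e.tendsto_proj x) ?_
  simp [h]

theorem exists_norm_coord_le [CompleteSpace X] {c : ℝ} (hc : 0 < c) (he : ∀ i, c ≤ ‖e i‖) :
    ∃ C : ℝ, 0 < C ∧ ∀ i, ‖e.coord i‖ ≤ C := by
  obtain ⟨C, hC⟩ := e.exists_norm_proj_le
  refine ⟨2 * max C 1 / c, by positivity, fun i => ?_⟩
  refine (e.coord i).opNorm_le_bound (by positivity) fun x => ?_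
  rw [div_mul_eq_mul_div, mul_assoc]
  refine norm_coeff_le_of_norm_sum_range_le (a := fun i => e.coord i x) hc he (fun N => ?_) i
  rw [← e.proj_apply]
  exact (e.proj N).le_of_opNorm_le ((hC N).trans (le_max_left _ _)) x

theorem separableSpace_of_schauderBasis [TopologicalSpace.SeparableSpace 𝕜]
    (e : SchauderBasis 𝕜 X) : TopologicalSpace.SeparableSpace X := by
  rw [← TopologicalSpace.isSeparable_univ_iff]
  have hspan : TopologicalSpace.IsSeparable (Submodule.span 𝕜 (Set.range e) : Set X) :=
    (Set.countable_range e).isSeparable.span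
  refine hspan.closure.mono fun x _ => ?_
  refine mem_closure_of_tendsto (e.tendsto_proj x) (Eventually.of_forall fun N => ?_)
  rw [e.proj_apply]
  exact Submodule.sum_mem _ fun i _ => Submodule.smul_mem _ _ (Submodule.subset_span ⟨i, rfl⟩)

end SchauderBasis

section LatticeSubgroup

variable {X : Type*} [NormedAddCommGroup X] [NormedSpace ℝ X] (e : SchauderBasis ℝ X) {n : ℕ → ℕ}

/-- The subgroup of those vectors of `X` whose expansion has the form `∑ (k i / n i) e i` with
integers `k i`; the set `A` of the theorem is its image under `cantorHom`. -/
noncomputable def latticeSubgroup (n : ℕ → ℕ) : AddSubgroup X :=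
  ⨅ i, (AddSubgroup.zmultiples (n i : ℝ)⁻¹).comap (e.coord i : X →+ ℝ)

theorem mem_latticeSubgroup {x : X} :
    x ∈ latticeSubgroup e n ↔ ∃ k : ℕ → ℤ, ∀ i, e.coord i x = k i / n i := by
  rw [← Classical.skolem (p := fun i (k : ℤ) => e.coord i x = k / n i)]
  simp [latticeSubgroup, AddSubgroup.mem_iInf, AddSubgroup.mem_zmultiples_iff, div_eq_mul_inv,
    eq_comm]

theorem isClosed_latticeSubgroup (n : ℕ → ℕ) : IsClosed (latticeSubgroup e n : Set X) := by
  rw [latticeSubgroup, AddSubgroup.coe_iInf]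
  exact isClosed_iInter fun i =>
    (AddSubgroup.isClosed_of_discrete (H := AddSubgroup.zmultiples _)).preimage
      (e.coord i).continuous

theorem inv_smul_mem_latticeSubgroup (n : ℕ → ℕ) (i : ℕ) :
    (n i : ℝ)⁻¹ • e i ∈ latticeSubgroup e n := by
  refine (mem_latticeSubgroup e).2 ⟨Pi.single i 1, fun j => ?_⟩
  obtain rfl | hj := eq_or_ne j i
  · simp [e.ortho]
  · simp [e.ortho, hj]

theorem exists_norm_zsmul_mem_Icc {E : Type*} [NormedAddCommGroup E] [NormedSpace ℝ E] {v : E}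
    (hv : v ≠ 0) {r : ℝ} (hr : ‖v‖ ≤ r / 2) : ∃ m : ℤ, ‖m • v‖ ∈ Set.Icc (r / 2) r := by
  have hv0 : 0 < ‖v‖ := norm_pos_iff.2 hv
  have hfloor : (0 : ℝ) ≤ ⌊r / ‖v‖⌋ :=
    Int.cast_nonneg (Int.floor_nonneg.2 (div_nonneg (by linarith) hv0.le))
  have hle : ⌊r / ‖v‖⌋ * ‖v‖ ≤ r := (le_div_iff₀ hv0).1 (Int.floor_le _)
  have hlt : r < (⌊r / ‖v‖⌋ + 1) * ‖v‖ := (div_lt_iff₀ hv0).1 (Int.lt_floor_add_one _)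
  refine ⟨⌊r / ‖v‖⌋, ?_⟩
  rw [← Int.cast_smul_eq_zsmul ℝ, norm_smul, Real.norm_of_nonneg hfloor]
  exact ⟨by linarith, hle⟩

/- A multiple of `(n i)⁻¹ • e i` of norm about `r` lies in the subgroup for infinitely many `i`;
a limit of such vectors has all coordinates `0`. -/
theorem not_locallyCompactSpace_latticeSubgroup (hn : ∀ i, n i ≠ 0)
    (hlim : MapClusterPt 0 atTop fun i => ‖e i‖ / (n i : ℝ)) :
    ¬ LocallyCompactSpace (latticeSubgroup e n) := by
  intro hlc
  obtain ⟨r, hr, hball⟩ := Metric.exists_isCompact_closedBall (0 : latticeSubgroup e n)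
  let v (i : ℕ) : latticeSubgroup e n := ⟨(n i : ℝ)⁻¹ • e i, inv_smul_mem_latticeSubgroup e n i⟩
  have hnorm (i : ℕ) : ‖(v i : X)‖ = ‖e i‖ / n i := by
    simp [v, norm_smul, div_eq_inv_mul]
  have hv0 (i : ℕ) : (v i : X) ≠ 0 :=
    smul_ne_zero (inv_ne_zero (Nat.cast_ne_zero.2 (hn i))) (e.linearIndependent.ne_zero i)
  choose! m hm using fun i (hi : ‖(v i : X)‖ ≤ r / 2) => exists_norm_zsmul_mem_Icc (hv0 i) hi
  have hshell : IsCompact (Metric.closedBall 0 r ∩ {y : latticeSubgroup e n | r / 2 ≤ ‖y‖}) :=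
    hball.inter_right (isClosed_le continuous_const continuous_norm)
  have hfreq : ∃ᶠ i in atTop, m i • v i ∈
      Metric.closedBall 0 r ∩ {y : latticeSubgroup e n | r / 2 ≤ ‖y‖} := by
    refine (hlim.frequently (Iio_mem_nhds (half_pos hr))).mono fun i hi => ?_
    have := hm i ((hnorm i).trans_le (Set.mem_Iio.1 hi).le)
    exact ⟨mem_closedBall_zero_iff.2 this.2, this.1⟩
  obtain ⟨z, ⟨-, hz⟩, φ, hφ, hφz⟩ := hshell.tendsto_subseq' hfreq
  have hz0 : (z : X) = 0 := eq_zero_of_coord_eq_zero e fun j => by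
    refine tendsto_nhds_unique
      ((((e.coord j).continuous.comp continuous_subtype_val).tendsto z).comp hφz) ?_
    refine tendsto_const_nhds.congr' ?_
    filter_upwards [hφ.tendsto_atTop.eventually_gt_atTop j] with i hi
    simp [v, e.ortho, hi.ne]
  have : ‖z‖ = 0 := by rw [AddSubgroup.coe_norm, hz0, norm_zero]
  rw [Set.mem_ofPred_eq] at hz
  linarith

end LatticeSubgroup

section CantorHom

variable {X : Type*} [NormedAddCommGroup X] [NormedSpace ℝ X] (e : SchauderBasis ℝ X) {n : ℕ → ℕ}

/-- The functional `x ↦ ∑ x i / (n 0 * ⋯ * n (i - 1))`, where `x i` are the coordinates of `x`. It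
takes the junk value `0` if the coordinate functionals, weighted in this way, are not summable. -/
noncomputable def cantorFunctional (n : ℕ → ℕ) : StrongDual ℝ X :=
  ∑' i, (∏ l ∈ Finset.range i, (n l : ℝ))⁻¹ • e.coord i

/-- The homomorphism `∑ (k i / n i) e i ↦ ∑ k i / (n 0 * ⋯ * n i)`. -/
noncomputable def cantorHom (n : ℕ → ℕ) : latticeSubgroup e n →+ ℝ :=
  (cantorFunctional e n : X →+ ℝ).comp (latticeSubgroup e n).subtype

theorem continuous_cantorHom (n : ℕ → ℕ) : Continuous (cantorHom e n) :=
  (cantorFunctional e n).continuous.comp continuous_subtype_val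

theorem seriesConverges_basisTerm_iff {k : ℕ → ℤ} :
    SeriesConverges (basisTerm e n k) ↔ ∃ x, ∀ i, e.coord i x = k i / n i :=
  seriesConverges_smul_iff e

variable [CompleteSpace X] {c : ℝ}

theorem hasSum_cantorFunctional (hc : 0 < c) (he : ∀ i, c ≤ ‖e i‖) (hn : ∀ i, 2 ≤ n i) (x : X) :
    HasSum (fun i => e.coord i x / ∏ l ∈ Finset.range i, (n l : ℝ)) (cantorFunctional e n x) := by
  obtain ⟨C, -, hC⟩ := exists_norm_coord_le e hc he
  have hsum : Summable fun i => (∏ l ∈ Finset.range i, (n l : ℝ))⁻¹ • e.coord i := by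
    refine .of_norm ((summable_div_prod_range hn (a := fun i => ‖e.coord i‖) (M := C)
      fun i => ?_).congr fun i => ?_)
    · rw [abs_norm]
      exact hC i
    · rw [norm_smul, norm_inv, Real.norm_of_nonneg (prod_range_cast_pos hn i).le, div_eq_inv_mul]
  simpa [div_eq_inv_mul] using! (ContinuousLinearMap.apply ℝ ℝ x).hasSum hsum.hasSum

theorem hasSum_cantorTerm (hc : 0 < c) (he : ∀ i, c ≤ ‖e i‖) (hn : ∀ i, 2 ≤ n i) {k : ℕ → ℤ}
    {x : X} (hx : ∀ i, e.coord i x = k i / n i) :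
    HasSum (cantorTerm n k) (cantorFunctional e n x) := by
  simpa only [cantorTerm_eq_div_prod_range, hx] using hasSum_cantorFunctional e hc he hn x

theorem seriesConverges_cantorTerm (hc : 0 < c) (he : ∀ i, c ≤ ‖e i‖) (hn : ∀ i, 2 ≤ n i)
    {k : ℕ → ℤ} (hk : SeriesConverges (basisTerm e n k)) : SeriesConverges (cantorTerm n k) := by
  obtain ⟨x, hx⟩ := (seriesConverges_basisTerm_iff e).1 hk
  exact ⟨_, (hasSum_cantorTerm e hc he hn hx).tendsto_sum_nat⟩

theorem isDiscrete_ker_cantorHom (hc : 0 < c) (he : ∀ i, c ≤ ‖e i‖) (hn : ∀ i, 2 ≤ n i) :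
    IsDiscrete ((cantorHom e n).ker : Set (latticeSubgroup e n)) := by
  obtain ⟨C, hC0, hC⟩ := exists_norm_coord_le e hc he
  refine ⟨discreteTopology_of_isOpen_singleton_zero
    (Metric.isOpen_singleton_iff.2 ⟨1 / 4 / C, by positivity, fun y hy => ?_⟩)⟩
  obtain ⟨k, hk⟩ := (mem_latticeSubgroup e).1 y.1.2
  have hsmall (i : ℕ) : |(k i / n i : ℝ)| ≤ 1 / 4 := by
    rw [← hk, ← Real.norm_eq_abs, ← mul_div_cancel₀ (1 / 4 : ℝ) hC0.ne']
    exact (e.coord i).le_of_opNorm_le_of_le (hC i) (dist_zero_right y ▸ hy).le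
  have hsum : HasSum (cantorTerm n k) 0 :=
    (show cantorFunctional e n y.1 = 0 from y.2) ▸ hasSum_cantorTerm e hc he hn hk
  have hk0 := eq_zero_of_hasSum_cantorTerm_zero hn (by norm_num) hsmall hsum
  exact Subtype.ext <| Subtype.ext <| eq_zero_of_coord_eq_zero e fun i => by simp [hk, hk0]

theorem banachSubgroupSet_eq_range (hc : 0 < c) (he : ∀ i, c ≤ ‖e i‖) (hn : ∀ i, 2 ≤ n i) :
    banachSubgroupSet e n = Set.range (cantorHom e n) := by
  ext t
  constructor
  · rintro ⟨k, hk, ht⟩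
    obtain ⟨x, hx⟩ := (seriesConverges_basisTerm_iff e).1 hk
    exact ⟨⟨x, (mem_latticeSubgroup e).2 ⟨k, hx⟩⟩,
      tendsto_nhds_unique (hasSum_cantorTerm e hc he hn hx).tendsto_sum_nat ht⟩
  · rintro ⟨y, rfl⟩
    obtain ⟨k, hk⟩ := (mem_latticeSubgroup e).1 y.2
    exact ⟨k, (seriesConverges_basisTerm_iff e).2 ⟨y, hk⟩,
      (hasSum_cantorTerm e hc he hn hk).tendsto_sum_nat⟩

end CantorHom

section BoundedlyComplete

variable {X : Type*} [NormedAddCommGroup X] [NormedSpace ℝ X] (e : SchauderBasis ℝ X) {n : ℕ → ℕ}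
  {c : ℝ}

/-- The integer sequences `k` for which the partial sums of `∑ (k i / n i) e i` are bounded by `M`.
For a boundedly complete basis, their union over `M` consists of all `k` occurring in
`banachSubgroupSet`. -/
def boundedDigitSet (n : ℕ → ℕ) (M : ℝ) : Set (ℕ → ℤ) :=
  {k | ∀ N, ‖∑ i ∈ Finset.range N, basisTerm e n k i‖ ≤ M}

theorem abs_div_le_of_mem_boundedDigitSet (hc : 0 < c) (he : ∀ i, c ≤ ‖e i‖) {M : ℝ} {k : ℕ → ℤ}
    (hk : k ∈ boundedDigitSet e n M) (i : ℕ) : |(k i / n i : ℝ)| ≤ 2 * M / c :=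
  norm_coeff_le_of_norm_sum_range_le hc he hk i

theorem isCompact_boundedDigitSet (hc : 0 < c) (he : ∀ i, c ≤ ‖e i‖) (hn : ∀ i, n i ≠ 0) (M : ℝ) :
    IsCompact (boundedDigitSet e n M) := by
  have hclosed : IsClosed (boundedDigitSet e n M) := by
    simp only [boundedDigitSet, Set.ofPred_forall]
    refine isClosed_iInter fun N => isClosed_le
      (continuous_finsetSum _ fun i _ => ?_).norm continuous_const
    have hdigit : Continuous fun m : ℤ => ((m : ℝ) / n i) • e i := continuous_of_discreteTopology
    exact hdigit.comp (continuous_apply i)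
  have hbox := isCompact_univ_pi fun i =>
    (Set.finite_Icc (-⌈2 * M / c * n i⌉) ⌈2 * M / c * n i⌉).isCompact
  refine hbox.of_isClosed_subset hclosed fun k hk i _ => abs_le.1 ?_
  have hni : (0 : ℝ) < n i := Nat.cast_pos.2 (Nat.pos_of_ne_zero (hn i))
  have hki := abs_div_le_of_mem_boundedDigitSet e hc he hk i
  rw [abs_div, abs_of_pos hni, div_le_iff₀ hni] at hki
  exact_mod_cast hki.trans (Int.le_ceil _)

theorem banachSubgroupSet_eq_iUnion_image (hc : 0 < c) (he : ∀ i, c ≤ ‖e i‖)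
    (hn : ∀ i, 2 ≤ n i) (hb : IsBoundedlyComplete e) :
    banachSubgroupSet e n =
      ⋃ M : ℕ, (fun k => ∑' i, cantorTerm n k i) '' boundedDigitSet e n M := by
  have hsum {M : ℝ} {k : ℕ → ℤ} (hk : k ∈ boundedDigitSet e n M) :
      Tendsto (fun N => ∑ i ∈ Finset.range N, cantorTerm n k i) atTop
        (𝓝 (∑' i, cantorTerm n k i)) :=
    (summable_cantorTerm hn
      (abs_div_le_of_mem_boundedDigitSet e hc he hk)).tendsto_sum_tsum_nat
  ext t
  simp only [Set.mem_iUnion, Set.mem_image]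
  constructor
  · rintro ⟨k, ⟨s, hs⟩, ht⟩
    obtain ⟨R, hR⟩ := isBounded_iff_forall_norm_le.1 (Metric.isBounded_range_of_tendsto _ hs)
    obtain ⟨M, hM⟩ := exists_nat_ge R
    have hk : k ∈ boundedDigitSet e n M := fun N => (hR _ (Set.mem_range_self N)).trans hM
    exact ⟨M, k, hk, tendsto_nhds_unique (hsum hk) ht⟩
  · rintro ⟨M, k, hk, rfl⟩
    exact ⟨k, hb _ ⟨M, hk⟩, hsum hk⟩

theorem isSigmaCompact_banachSubgroupSet (hc : 0 < c) (he : ∀ i, c ≤ ‖e i‖) (hn : ∀ i, 2 ≤ n i)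
    (hb : IsBoundedlyComplete e) : IsSigmaCompact (banachSubgroupSet e n) := by
  rw [banachSubgroupSet_eq_iUnion_image e hc he hn hb]
  refine isSigmaCompact_iUnion_of_isCompact _ fun M => ?_
  have hn0 (i : ℕ) : n i ≠ 0 := (two_pos.trans_le (hn i)).ne'
  exact (isCompact_boundedDigitSet e hc he hn0 M).image_of_continuousOn
    ((continuousOn_tsum_cantorTerm hn _).mono fun k hk =>
      abs_div_le_of_mem_boundedDigitSet e hc he hk)

end BoundedlyComplete

section Lp

variable {p : ENNReal} [Fact (1 ≤ p)]

/-- The standard unit vectors as a Schauder basis of `ℓᵖ`, `p < ∞`. -/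
noncomputable def lpStandardBasis (hp : p ≠ ⊤) : SchauderBasis ℝ (lp (fun _ : ℕ => ℝ) p) where
  basis i := lp.single p i (1 : ℝ)
  coord i := lp.evalCLM ℝ (fun _ : ℕ => ℝ) p i
  ortho i j := by simp [lp.evalCLM, Pi.single_apply]
  expansion x := by
    have h := (lp.hasSum_single hp x).mono_left (SummationFilter.conditional ℕ).le_atTop
    refine h.congr fun s => Finset.sum_congr rfl fun i _ => ?_
    change lp.single p i (x i) = x i • lp.single (E := fun _ : ℕ => ℝ) p i 1
    rw [← lp.single_smul, smul_eq_mul, mul_one]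

theorem lpStandardBasis_apply (hp : p ≠ ⊤) (i : ℕ) :
    lpStandardBasis hp i = lp.single p i (1 : ℝ) :=
  rfl

theorem smul_lpStandardBasis (hp : p ≠ ⊤) (a : ℝ) (i : ℕ) :
    a • lpStandardBasis hp i = lp.single p i a := by
  rw [lpStandardBasis_apply, ← lp.single_smul, smul_eq_mul, mul_one]

theorem norm_lpStandardBasis (hp : p ≠ ⊤) (i : ℕ) : ‖lpStandardBasis hp i‖ = 1 := by
  rw [lpStandardBasis_apply, lp.norm_single (zero_lt_one.trans_le Fact.out), norm_one]

theorem isBoundedlyComplete_lpStandardBasis (hp : p ≠ ⊤) :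
    IsBoundedlyComplete (lpStandardBasis hp) := by
  rintro a ⟨M, hM⟩
  have hp0 : 0 < p.toReal := ENNReal.toReal_pos (zero_lt_one.trans_le Fact.out).ne' hp
  simp only [smul_lpStandardBasis] at hM ⊢
  have hmem : Memℓp a p := by
    refine memℓp_gen (summable_of_sum_range_le (c := M ^ p.toReal) (fun i => by positivity)
      fun N => ?_)
    rw [← lp.norm_sum_single hp0 a]
    exact Real.rpow_le_rpow (norm_nonneg _) (hM N) hp0.le
  exact ⟨_, (lp.hasSum_single hp (⟨a, hmem⟩ : lp (fun _ : ℕ => ℝ) p)).tendsto_sum_nat⟩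

end Lp

theorem theorem3p6_general {X : Type*} [NormedAddCommGroup X] [NormedSpace ℝ X] [CompleteSpace X]
    (e : SchauderBasis ℝ X) {c : ℝ} (hc : 0 < c) (he : ∀ i, c ≤ ‖e i‖) {n : ℕ → ℕ}
    (hn : ∀ i, 2 ≤ n i) (hlim : MapClusterPt 0 atTop fun i => ‖e i‖ / (n i : ℝ)) :
    (∀ k : ℕ → ℤ, SeriesConverges (basisTerm e n k) → SeriesConverges (cantorTerm n k)) ∧
    MeasurableSet (banachSubgroupSet e n) ∧
    (∃ H : AddSubgroup ℝ, (H : Set ℝ) = banachSubgroupSet e n) ∧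
    ¬ IsCountableUnionOfMeasured (banachSubgroupSet e n) ∧
    (IsBoundedlyComplete e → IsSigmaCompact (banachSubgroupSet e n)) := by
  have := separableSpace_of_schauderBasis e
  have : SecondCountableTopology X := UniformSpace.secondCountable_of_separable X
  have : CompleteSpace (latticeSubgroup e n) := (isClosed_latticeSubgroup e n).completeSpace_coe
  have hcont := continuous_cantorHom e n
  have hrange := banachSubgroupSet_eq_range e hc he hn
  have hn0 (i : ℕ) : n i ≠ 0 := (two_pos.trans_le (hn i)).ne'
  refine ⟨fun k => seriesConverges_cantorTerm e hc he hn, ?_, ⟨(cantorHom e n).range, ?_⟩, ?_,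
    isSigmaCompact_banachSubgroupSet e hc he hn⟩
  · exact hrange ▸ measurableSet_range_of_continuous hcont
  · rw [hrange, AddMonoidHom.coe_range]
  · exact hrange ▸ not_isCountableUnionOfMeasured_range
      (not_locallyCompactSpace_latticeSubgroup e hn0 hlim) hcont
      (isDiscrete_ker_cantorHom e hc he hn)

theorem theorem3p6 :
    (∀ (X : Type*) [NormedAddCommGroup X] [NormedSpace ℝ X] [CompleteSpace X]
      (e : SchauderBasis ℝ X) (_ : ∀ i, ‖e i‖ = 1)
      (n : ℕ → ℕ) (_ : 2 ≤ n 0) (_ : Monotone n) (_ : Tendsto n atTop atTop),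
      (∀ k : ℕ → ℤ, SeriesConverges (basisTerm e n k) → SeriesConverges (cantorTerm n k)) ∧
      MeasurableSet (banachSubgroupSet e n) ∧
      (∃ H : AddSubgroup ℝ, (H : Set ℝ) = banachSubgroupSet e n) ∧
      ¬ IsCountableUnionOfMeasured (banachSubgroupSet e n) ∧
      (IsBoundedlyComplete e → IsSigmaCompact (banachSubgroupSet e n))) ∧
    (∀ (p : ENNReal) [Fact (1 ≤ p)], p ≠ ⊤ →
      ∃ e : SchauderBasis ℝ (lp (fun _ : ℕ => ℝ) p),
        (∀ i, e i = lp.single p i (1 : ℝ)) ∧ (∀ i, ‖e i‖ = 1) ∧ IsBoundedlyComplete e) := by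
  refine ⟨fun X _ _ _ e he n hn0 hmono hlim => ?_, fun p _ hp => ⟨lpStandardBasis hp,
    lpStandardBasis_apply hp, norm_lpStandardBasis hp, isBoundedlyComplete_lpStandardBasis hp⟩⟩
  refine theorem3p6_general e one_pos (fun i => (he i).ge)
    (fun i => hn0.trans (hmono (Nat.zero_le i))) (Tendsto.mapClusterPt ?_)
  simpa only [he, Function.comp_def] using
    tendsto_const_nhds.div_atTop (tendsto_natCast_atTop_atTop.comp hlim)
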